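/- Let $A\to M$ be a smooth real vector bundle of finite rank over a smooth manifold, equipped with a Lie algebroid structure $\mu$, that is, an anchor $\rho:A\to TM$ and a Lie bracket on $\Gamma(A)$ with $[X,fY]=f[X,Y]+(\rho(X)f)Y$. Let $d_\mu$ be the Lie algebroid differential on $\Gamma(\wedge^\bullet A^*)$. For a bivector $\pi\in\Gamma(\wedge^2A)$ put $\pi^\sharp\alpha=i_\alpha\pi$, and for a $2$-form $\omega\in\Gamma(\wedge^2A^*)$ put $\omega^\flat X=-i_X\omega$. The bivector $\pi$ is Poisson if its Schouten bracket satisfies $[\pi,\pi]_\mu=0$. Let $[\ ,\ ]_\pi$ denote the Koszul bracket on $\Gamma(\wedge^\bullet A^*)$: the Gerstenhaber bracket which extends $$[\alpha,f]_\pi=(\rho\circ\pi^\sharp)(\alpha)\cdot f,\qquad [\alpha,\beta]_\pi=\mathcal L^\mu_{\pi^\sharp\alpha}\beta-\mathcal L^\mu_{\pi^\sharp\beta}\alpha-d_\mu(\pi(\alpha,\beta)),\qquad f\in C^\infty(M),\ \alpha,\beta\in\Gamma(A^*).$$ A $2$-form $\omega$ is called complementary for $\pi$ if $[\omega,\omega]_\pi=0$.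 The pair $(\pi,\omega)$ is called a $P\Omega$-structure if $\pi$ is a Poisson bivector, $d_\mu\omega=0$ and $d_\mu(\omega_N)=0$, where $N=\pi^\sharp\circ\omega^\flat$ and $\omega_N$ is the $2$-form with $\omega_N^\flat=\omega^\flat\circ N$. Theorem. Let $\pi$ be a Poisson bivector and $\omega$ a $2$-form on the Lie algebroid $(A,\mu)$. Then $(\pi,\omega)$ is a $P\Omega$-structure if and only if $d_\mu\omega=0$ and $\omega$ is complementary for $\pi$, i.e. $[\omega,\omega]_\pi=0$. -/

import Mathlib

set_option linter.unusedSectionVars false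

open Function
open scoped Manifold ContDiff

noncomputable section

/-! ## Lie algebroids -/

section Geometry

variable {E : Type*} [NormedAddCommGroup E] [NormedSpace ℝ E]
  {M : Type*} [TopologicalSpace M] [ChartedSpace E M] [IsManifold 𝓘(ℝ, E) ∞ M]
  {F : Type*} [NormedAddCommGroup F] [NormedSpace ℝ F]
  {A : M → Type*} [TopologicalSpace (Bundle.TotalSpace F A)]
  [∀ x, TopologicalSpace (A x)] [∀ x, AddCommGroup (A x)] [∀ x, Module ℝ (A x)]
  [FiberBundle F A] [VectorBundle ℝ F A] [ContMDiffVectorBundle ∞ F A 𝓘(ℝ, E)]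

/-- Smooth sections form a module over the ring of smooth functions, with pointwise operations. -/
instance : SMul C^∞⟮𝓘(ℝ, E), M; ℝ⟯ Cₛ^∞⟮𝓘(ℝ, E); F, A⟯ where
  smul f s := ⟨fun x => f x • s x, f.contMDiff.smul_section s.contMDiff⟩

theorem smul_section_apply (f : C^∞⟮𝓘(ℝ, E), M; ℝ⟯) (s : Cₛ^∞⟮𝓘(ℝ, E); F, A⟯) (x : M) :
    (f • s) x = f x • s x := rfl

instance : Module C^∞⟮𝓘(ℝ, E), M; ℝ⟯ Cₛ^∞⟮𝓘(ℝ, E); F, A⟯ where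
  one_smul s := by ext x; simp [smul_section_apply]
  mul_smul f g s := by ext x; simp [smul_section_apply, mul_smul]
  smul_zero f := by ext x; simp [smul_section_apply]
  smul_add f s t := by ext x; simp [smul_section_apply]
  add_smul f g s := by ext x; simp [smul_section_apply, add_smul]
  zero_smul s := by ext x; simp [smul_section_apply]

theorem contMDiff_anchorDeriv
    (a : Cₛ^∞⟮𝓘(ℝ, E); F →L[ℝ] E, fun x => A x →L[ℝ] TangentSpace 𝓘(ℝ, E) x⟯)
    (X : Cₛ^∞⟮𝓘(ℝ, E); F, A⟯) (f : C^∞⟮𝓘(ℝ, E), M; ℝ⟯) :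
    ContMDiff 𝓘(ℝ, E) 𝓘(ℝ, ℝ) ∞ (fun x => mvfderiv 𝓘(ℝ, E) f x (a x (X x))) := by
  have h1 := a.contMDiff.clm_bundle_apply X.contMDiff
  have h2 : ContMDiff 𝓘(ℝ, E).tangent 𝓘(ℝ, ℝ).tangent ∞ (tangentMap 𝓘(ℝ, E) 𝓘(ℝ, ℝ) f) :=
    f.contMDiff.contMDiff_tangentMap (by simp)
  exact ((contMDiff_snd_tangentBundle_modelSpace ℝ 𝓘(ℝ, ℝ)).comp h2).comp h1

/-- The derivative of the function `f` along the vector field `a(X)`. -/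
def anchorDeriv (a : Cₛ^∞⟮𝓘(ℝ, E); F →L[ℝ] E, fun x => A x →L[ℝ] TangentSpace 𝓘(ℝ, E) x⟯)
    (X : Cₛ^∞⟮𝓘(ℝ, E); F, A⟯) (f : C^∞⟮𝓘(ℝ, E), M; ℝ⟯) : C^∞⟮𝓘(ℝ, E), M; ℝ⟯ :=
  ⟨fun x => mvfderiv 𝓘(ℝ, E) f x (a x (X x)), contMDiff_anchorDeriv a X f⟩

theorem anchorDeriv_add_left
    (a : Cₛ^∞⟮𝓘(ℝ, E); F →L[ℝ] E, fun x => A x →L[ℝ] TangentSpace 𝓘(ℝ, E) x⟯)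
    (X Y : Cₛ^∞⟮𝓘(ℝ, E); F, A⟯) (f : C^∞⟮𝓘(ℝ, E), M; ℝ⟯) :
    anchorDeriv a (X + Y) f = anchorDeriv a X f + anchorDeriv a Y f := by
  ext x
  change mvfderiv 𝓘(ℝ, E) f x (a x (X x + Y x)) = _
  rw [map_add, map_add]
  rfl

theorem anchorDeriv_smul_left
    (a : Cₛ^∞⟮𝓘(ℝ, E); F →L[ℝ] E, fun x => A x →L[ℝ] TangentSpace 𝓘(ℝ, E) x⟯)
    (f : C^∞⟮𝓘(ℝ, E), M; ℝ⟯) (X : Cₛ^∞⟮𝓘(ℝ, E); F, A⟯) (g : C^∞⟮𝓘(ℝ, E), M; ℝ⟯) :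
    anchorDeriv a (f • X) g = f * anchorDeriv a X g := by
  ext x
  change mvfderiv 𝓘(ℝ, E) g x (a x (f x • X x)) = _
  rw [map_smul, map_smul]
  rfl

theorem anchorDeriv_add_right
    (a : Cₛ^∞⟮𝓘(ℝ, E); F →L[ℝ] E, fun x => A x →L[ℝ] TangentSpace 𝓘(ℝ, E) x⟯)
    (X : Cₛ^∞⟮𝓘(ℝ, E); F, A⟯) (f g : C^∞⟮𝓘(ℝ, E), M; ℝ⟯) :
    anchorDeriv a X (f + g) = anchorDeriv a X f + anchorDeriv a X g := by
  ext x
  change mvfderiv 𝓘(ℝ, E) (⇑f + ⇑g) x _ = _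
  rw [mvfderiv_add f.mdifferentiableAt g.mdifferentiableAt]
  rfl

theorem anchorDeriv_mul_right
    (a : Cₛ^∞⟮𝓘(ℝ, E); F →L[ℝ] E, fun x => A x →L[ℝ] TangentSpace 𝓘(ℝ, E) x⟯)
    (X : Cₛ^∞⟮𝓘(ℝ, E); F, A⟯) (f g : C^∞⟮𝓘(ℝ, E), M; ℝ⟯) :
    anchorDeriv a X (f * g) = f * anchorDeriv a X g + anchorDeriv a X f * g := by
  ext x
  change mvfderiv 𝓘(ℝ, E) (⇑f * ⇑g) x _ = f x * mvfderiv 𝓘(ℝ, E) g x (a x (X x)) +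
    mvfderiv 𝓘(ℝ, E) f x (a x (X x)) * g x
  rw [mvfderiv_mul f.mdifferentiableAt g.mdifferentiableAt]
  simp [mul_comm]

variable (E F A) in
/-- A Lie algebroid structure on the smooth vector bundle `A` (with model fibre `F`) over the smooth
manifold `M` (modelled on `E`): a smooth bundle map `ρ : A → TM`, the anchor, and a Lie bracket on
the space of smooth sections such that `[X, fY] = f[X, Y] + (ρ(X)f)Y` and
`ρ[X, Y] = [ρX, ρY]` (as derivations of `C^∞(M)`). -/
structure LieAlgebroid where
  anchor : Cₛ^∞⟮𝓘(ℝ, E); F →L[ℝ] E, fun x => A x →L[ℝ] TangentSpace 𝓘(ℝ, E) x⟯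
  bracket : Cₛ^∞⟮𝓘(ℝ, E); F, A⟯ →ₗ[ℝ] Cₛ^∞⟮𝓘(ℝ, E); F, A⟯ →ₗ[ℝ] Cₛ^∞⟮𝓘(ℝ, E); F, A⟯
  bracket_self : ∀ X, bracket X X = 0
  jacobi : ∀ X Y Z, bracket X (bracket Y Z) = bracket (bracket X Y) Z + bracket Y (bracket X Z)
  leibniz : ∀ X (f : C^∞⟮𝓘(ℝ, E), M; ℝ⟯) Y,
    bracket X (f • Y) = f • bracket X Y + anchorDeriv anchor X f • Y
  anchor_bracket : ∀ X Y f, anchorDeriv anchor (bracket X Y) f =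
    anchorDeriv anchor X (anchorDeriv anchor Y f) - anchorDeriv anchor Y (anchorDeriv anchor X f)

namespace LieAlgebroid

/-- The space `Γ(A)` of smooth sections of a Lie algebroid. It is a module over `C^∞(M)` and, with
`⁅X, Y⁆` the algebroid bracket and `⁅X, f⁆ = ρ(X)f`, a Lie–Rinehart algebra. -/
def Sec (_ : LieAlgebroid E F A) : Type _ := Cₛ^∞⟮𝓘(ℝ, E); F, A⟯

variable (𝓐 : LieAlgebroid E F A)

instance : AddCommGroup 𝓐.Sec := inferInstanceAs (AddCommGroup Cₛ^∞⟮𝓘(ℝ, E); F, A⟯)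

instance : Module C^∞⟮𝓘(ℝ, E), M; ℝ⟯ 𝓐.Sec :=
  inferInstanceAs (Module C^∞⟮𝓘(ℝ, E), M; ℝ⟯ Cₛ^∞⟮𝓘(ℝ, E); F, A⟯)

instance : LieRing 𝓐.Sec where
  bracket X Y := 𝓐.bracket X Y
  add_lie X Y Z := LinearMap.map_add₂ 𝓐.bracket X Y Z
  lie_add X Y Z := map_add (𝓐.bracket X) Y Z
  lie_self X := 𝓐.bracket_self X
  leibniz_lie X Y Z := 𝓐.jacobi X Y Z

instance : LieRingModule 𝓐.Sec C^∞⟮𝓘(ℝ, E), M; ℝ⟯ where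
  bracket X f := anchorDeriv 𝓐.anchor X f
  add_lie X Y f := anchorDeriv_add_left 𝓐.anchor X Y f
  lie_add X f g := anchorDeriv_add_right 𝓐.anchor X f g
  leibniz_lie X Y f := eq_add_of_sub_eq (𝓐.anchor_bracket X Y f).symm

instance : LieRinehartRing C^∞⟮𝓘(ℝ, E), M; ℝ⟯ 𝓐.Sec where
  lie_smul_eq_mul' f g X := anchorDeriv_smul_left 𝓐.anchor f X g
  leibniz_mul_right' X f g := anchorDeriv_mul_right 𝓐.anchor X f g
  leibniz_smul_right' X Y f := 𝓐.leibniz X f Y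

end LieAlgebroid
end Geometry

/-! ## Forms and bivectors

The exterior calculus of a Lie–Rinehart algebra `(R, L)`, which is applied to
`(C^∞(M), Γ(A))`; `⁅X, f⁆` is the derivative of `f : R` along `X : L`. -/

section Calculus

variable {R L : Type*} [CommRing R] [LieRing L] [Module R L]

/-- `k`-forms: alternating `R`-multilinear maps `L × ⋯ × L → R`. For `R = C^∞(M)` and `L = Γ(A)`
these are the smooth sections of `⋀^k A^*`. -/
abbrev Form (R L : Type*) [CommRing R] [AddCommGroup L] [Module R L] (k : ℕ) : Type _ :=
  L [⋀^Fin k]→ₗ[R] R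

/-- Bivectors: elements of the second exterior power of the `R`-module `L`. For `R = C^∞(M)` and
`L = Γ(A)` these are the smooth sections of `⋀^2 A`, as `Γ(⋀^2 A) = ⋀^2_{C^∞(M)} Γ(A)`. -/
abbrev Bivector (R L : Type*) [CommRing R] [AddCommGroup L] [Module R L] : Type _ :=
  ⋀[R]^2 L

namespace Form

section differential

variable [LieRingModule L R]

/-- The Chevalley–Eilenberg (Cartan) formula
`(dη)(X_0, …, X_k) = ∑_j (-1)^j ⁅X_j, η(X_0, …, X̂_j, …, X_k)⁆
  + ∑_{i<j} (-1)^{i+j} η([X_i, X_j], X_0, …, X̂_i, …, X̂_j, …, X_k)`.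
In the second sum `[X_i, X_j]` is written in the place of `X_i`, which turns the sign into
`(-1)^j`. -/
def extDerivFun {k : ℕ} (η : Form R L k) (X : Fin (k + 1) → L) : R :=
  ∑ j : Fin (k + 1), (-1) ^ (j : ℕ) * (⁅X j, η (j.removeNth X)⁆ +
    ∑ i ∈ Finset.univ.filter (fun i => i < j), η (j.removeNth (update X i ⁅X i, X j⁆)))

theorem update_eq_insertNth {k : ℕ} (Y : Fin (k + 1) → L) (j : Fin (k + 1)) (z : L) :
    update Y j z = j.insertNth z (j.removeNth Y) := by
  rw [Fin.insertNth_removeNth]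

theorem map_update_eq {k : ℕ} (η : Form R L (k + 1)) (Y : Fin (k + 1) → L) (j : Fin (k + 1))
    (z : L) : η (update Y j z) = (-1) ^ (j : ℕ) * η (Fin.cons z (j.removeNth Y)) := by
  rw [update_eq_insertNth, AlternatingMap.map_insertNth, Matrix.vecCons, zsmul_eq_mul]
  simp

/-- The value `(ℒ_x η)(Y)` of the Lie derivative. -/
def lieFun {k : ℕ} (x : L) (η : Form R L k) (Y : Fin k → L) : R :=
  ⁅x, η Y⁆ - ∑ j, η (update Y j ⁅x, Y j⁆)

theorem extDerivFun_cons {k : ℕ} (η : Form R L (k + 1)) (x : L) (Y : Fin (k + 1) → L) :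
    extDerivFun η (Fin.cons x Y) = lieFun x η Y - extDerivFun (η.curryLeft x) Y := by
  have key : ∀ j : Fin (k + 1), ∀ f : Fin (k + 2) → R,
      ∑ i ∈ Finset.univ.filter (fun i => i < j.succ), f i =
        f 0 + ∑ i ∈ Finset.univ.filter (fun i => i < j), f i.succ := by
    intro j f
    rw [Finset.sum_filter, Finset.sum_filter, Fin.sum_univ_succ]
    simp
  have hr : ∀ j : Fin (k + 1), ∀ (z : L) (Z : Fin (k + 1) → L),
      j.succ.removeNth (Fin.cons z Z : Fin (k + 2) → L) = Fin.cons z (j.removeNth Z) := by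
    intro j z Z
    funext i
    refine Fin.cases ?_ (fun i => ?_) i
    · simp [Fin.removeNth]
    · simp [Fin.removeNth]
  unfold extDerivFun lieFun
  rw [Fin.sum_univ_succ]
  simp only [key, Fin.cons_succ, Fin.cons_zero, Fin.update_cons_zero, ← Fin.cons_update, hr,
    map_update_eq, Fin.val_succ, AlternatingMap.curryLeft_apply_apply, Matrix.vecCons]
  have h0 : (0 : Fin (k + 2)).removeNth (Fin.cons x Y : Fin (k + 2) → L) = Y := by
    funext i; simp [Fin.removeNth]
  simp only [h0, Fin.not_lt_zero, Finset.filter_false, Finset.sum_empty]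
  simp only [Fin.val_zero, pow_zero, one_mul, add_zero]
  rw [sub_sub, sub_eq_add_neg, ← Finset.sum_add_distrib, ← Finset.sum_neg_distrib]
  congr 1
  refine Finset.sum_congr rfl fun j _ => ?_
  ring

theorem lieFun_update_add {k : ℕ} (x : L) (η : Form R L k) (Y : Fin k → L) (i : Fin k) (y z : L) :
    lieFun x η (update Y i (y + z)) = lieFun x η (update Y i y) + lieFun x η (update Y i z) := by
  have h : ∀ w : L, ∑ j, η (update (update Y i w) j ⁅x, update Y i w j⁆) =
      η (update Y i ⁅x, w⁆) + ∑ j ∈ Finset.univ.erase i, η (update (update Y j ⁅x, Y j⁆) i w) := by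
    intro w
    rw [← Finset.add_sum_erase _ _ (Finset.mem_univ i)]
    congr 1
    · simp
    · refine Finset.sum_congr rfl fun j hj => ?_
      have hji : j ≠ i := Finset.ne_of_mem_erase hj
      rw [update_of_ne hji, update_comm hji.symm]
  unfold lieFun
  rw [h, h, h]
  simp only [η.map_update_add, lie_add, Finset.sum_add_distrib]
  abel

variable [LieRinehartRing R L]

theorem lieFun_update_smul {k : ℕ} (x : L) (η : Form R L k) (Y : Fin k → L) (i : Fin k) (c : R)
    (y : L) :
    lieFun x η (update Y i (c • y)) = c * lieFun x η (update Y i y) := by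
  have h : ∀ w : L, ∑ j, η (update (update Y i w) j ⁅x, update Y i w j⁆) =
      η (update Y i ⁅x, w⁆) + ∑ j ∈ Finset.univ.erase i, η (update (update Y j ⁅x, Y j⁆) i w) := by
    intro w
    rw [← Finset.add_sum_erase _ _ (Finset.mem_univ i)]
    congr 1
    · simp
    · refine Finset.sum_congr rfl fun j hj => ?_
      have hji : j ≠ i := Finset.ne_of_mem_erase hj
      rw [update_of_ne hji, update_comm hji.symm]
  unfold lieFun
  rw [h, h]
  simp only [η.map_update_smul, η.map_update_add, LieRinehartRing.leibniz_smul_right,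
    smul_eq_mul, LieRinehartRing.leibniz_mul_right, ← Finset.mul_sum]
  ring

theorem lieFun_eq_zero {k : ℕ} (x : L) (η : Form R L k) (Y : Fin k → L) (i j : Fin k)
    (hY : Y i = Y j) (hij : i ≠ j) : lieFun x η Y = 0 := by
  unfold lieFun
  rw [η.map_eq_zero_of_eq Y hY hij, lie_zero, zero_sub, neg_eq_zero]
  rw [Fintype.sum_eq_add i j hij]
  · have : update Y j ⁅x, Y j⁆ = update Y i ⁅x, Y i⁆ ∘ Equiv.swap i j := by
      funext m
      simp only [comp_apply]
      rcases eq_or_ne m i with rfl | hmi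
      · simp [update_of_ne hij, update_of_ne hij.symm, hY]
      rcases eq_or_ne m j with rfl | hmj
      · simp [hY]
      · simp [Equiv.swap_apply_of_ne_of_ne hmi hmj, update_of_ne hmi, update_of_ne hmj]
    rw [this, η.map_swap _ hij]
    simp
  · rintro m ⟨hmi, hmj⟩
    exact η.map_eq_zero_of_eq _ (by rw [update_of_ne hmi.symm, update_of_ne hmj.symm, hY]) hij

theorem extDerivFun_smul {k : ℕ} (c : R) (η : Form R L k) (X : Fin (k + 1) → L) :
    extDerivFun (c • η) X = c * extDerivFun η X +
      ∑ j : Fin (k + 1), (-1) ^ (j : ℕ) * (⁅X j, c⁆ * η (j.removeNth X)) := by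
  unfold extDerivFun
  rw [Finset.mul_sum, ← Finset.sum_add_distrib]
  refine Finset.sum_congr rfl fun j _ => ?_
  simp only [AlternatingMap.smul_apply, smul_eq_mul, LieRinehartRing.leibniz_mul_right,
    ← Finset.mul_sum]
  ring

theorem extDerivFun_add {k : ℕ} (η ζ : Form R L k) (X : Fin (k + 1) → L) :
    extDerivFun (η + ζ) X = extDerivFun η X + extDerivFun ζ X := by
  unfold extDerivFun
  rw [← Finset.sum_add_distrib]
  refine Finset.sum_congr rfl fun j _ => ?_
  simp only [AlternatingMap.add_apply, lie_add, Finset.sum_add_distrib]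
  ring

theorem extDerivFun_zero_right {k : ℕ} (X : Fin (k + 1) → L) :
    extDerivFun (0 : Form R L k) X = 0 := by
  simp [extDerivFun]

theorem extDerivFun_multilinear {k : ℕ} (η : Form R L k) :
    (∀ (X : Fin (k + 1) → L) (i : Fin (k + 1)) (y z : L), extDerivFun η (update X i (y + z)) =
      extDerivFun η (update X i y) + extDerivFun η (update X i z)) ∧
    (∀ (X : Fin (k + 1) → L) (i : Fin (k + 1)) (c : R) (y : L),
      extDerivFun η (update X i (c • y)) = c * extDerivFun η (update X i y)) := by
  induction k with
  | zero =>
    have h : ∀ X : Fin 1 → L, extDerivFun η X = ⁅X 0, η Fin.elim0⁆ := by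
      intro X
      have : (0 : Fin 1).removeNth X = Fin.elim0 := Subsingleton.elim _ _
      simp [extDerivFun, this]
    constructor
    · intro X i y z
      obtain rfl : i = 0 := Fin.fin_one_eq_zero i
      simp [h]
    · intro X i c y
      obtain rfl : i = 0 := Fin.fin_one_eq_zero i
      simp [h]
  | succ k ih =>
    constructor
    · intro X i y z
      induction X using Fin.consCases with
      | _ x Y =>
      refine Fin.cases ?_ (fun i => ?_) i
      · simp only [Fin.update_cons_zero, extDerivFun_cons, map_add, extDerivFun_add, lieFun,
          add_lie, η.map_update_add, Finset.sum_add_distrib]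
        ring
      · simp only [← Fin.cons_update, extDerivFun_cons, lieFun_update_add, (ih _).1]
        ring
    · intro X i c y
      induction X using Fin.consCases with
      | _ x Y =>
      refine Fin.cases ?_ (fun i => ?_) i
      · simp only [Fin.update_cons_zero, extDerivFun_cons, map_smul, extDerivFun_smul, lieFun]
        have hb : ∀ j, ⁅c • y, Y j⁆ = c • ⁅y, Y j⁆ + (-⁅Y j, c⁆) • y := by
          intro j
          rw [← lie_skew, LieRinehartRing.leibniz_smul_right, ← lie_skew y (Y j)]
          simp only [neg_add, smul_neg, neg_smul]
        simp only [hb, η.map_update_add, η.map_update_smul, Finset.sum_add_distrib, smul_eq_mul,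
          ← Finset.mul_sum, LieRinehartRing.lie_smul_eq_mul]
        have hs : ∑ j, -⁅Y j, c⁆ * η (update Y j y) =
            -∑ j : Fin (k + 1), (-1) ^ (j : ℕ) * (⁅Y j, c⁆ * η.curryLeft y (j.removeNth Y)) := by
          rw [← Finset.sum_neg_distrib]
          refine Finset.sum_congr rfl fun j _ => ?_
          rw [map_update_eq, AlternatingMap.curryLeft_apply_apply, Matrix.vecCons]
          ring
        rw [hs]
        ring
      · simp only [← Fin.cons_update, extDerivFun_cons, lieFun_update_smul, (ih _).2]
        ring

theorem extDerivFun_eq_zero {k : ℕ} (η : Form R L k) (X : Fin (k + 1) → L) (i j : Fin (k + 1))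
    (hX : X i = X j) (hij : i ≠ j) : extDerivFun η X = 0 := by
  induction k with
  | zero => exact absurd ((Fin.fin_one_eq_zero i).trans (Fin.fin_one_eq_zero j).symm) hij
  | succ k ih =>
    -- the case where the first argument is repeated
    have key : ∀ (Y : Fin (k + 1) → L) (j : Fin (k + 1)),
        extDerivFun η (Fin.cons (Y j) Y) = 0 := by
      intro Y j
      rw [extDerivFun_cons]
      have h1 : extDerivFun (η.curryLeft (Y j)) Y =
          (-1) ^ (j : ℕ) * extDerivFun (η.curryLeft (Y j)) (Fin.cons (Y j) (j.removeNth Y)) := by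
        let D : Form R L (k + 1) :=
          { toFun := extDerivFun (η.curryLeft (Y j))
            map_update_add' := by
              intro _ X i y z
              convert (extDerivFun_multilinear (η.curryLeft (Y j))).1 X i y z
            map_update_smul' := by
              intro _ X i c y
              rw [smul_eq_mul]
              convert (extDerivFun_multilinear (η.curryLeft (Y j))).2 X i c y
            map_eq_zero_of_eq' := fun X i j h hij => ih _ X i j h hij }
        have := map_update_eq D Y j (Y j)
        rwa [update_eq_self] at this
      have h2 : lieFun (Y j) η Y =
          (-1) ^ (j : ℕ) * lieFun (Y j) η (Fin.cons (Y j) (j.removeNth Y)) := by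
        let D : Form R L (k + 1) :=
          { toFun := lieFun (Y j) η
            map_update_add' := by
              intro _ X i y z
              convert lieFun_update_add (Y j) η X i y z
            map_update_smul' := by
              intro _ X i c y
              rw [smul_eq_mul]
              convert lieFun_update_smul (Y j) η X i c y
            map_eq_zero_of_eq' := fun X i j h hij => lieFun_eq_zero _ _ X i j h hij }
        have := map_update_eq D Y j (Y j)
        rwa [update_eq_self] at this
      rw [h1, h2, ← mul_sub]
      generalize j.removeNth Y = Z
      generalize Y j = y
      cases k with
      | zero =>
        have : ∀ W : Fin 1 → L, extDerivFun (η.curryLeft y) W = ⁅W 0, η.curryLeft y Fin.elim0⁆ := by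
          intro W
          have : (0 : Fin 1).removeNth W = Fin.elim0 := Subsingleton.elim _ _
          simp [extDerivFun, this]
        rw [this]
        have hz : Z = Fin.elim0 := Subsingleton.elim _ _
        subst hz
        simp [lieFun, Matrix.vecCons]
        exact η.map_coord_zero 0 rfl
      | succ k =>
        rw [extDerivFun_cons]
        have : (η.curryLeft y).curryLeft y = 0 := AlternatingMap.curryLeft_same η y
        rw [this, extDerivFun_zero_right]
        simp [lieFun, Fin.sum_univ_succ, Fin.update_cons_zero, ← Fin.cons_update, Matrix.vecCons]
        exact η.map_coord_zero 0 rfl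
    induction X using Fin.consCases with
    | _ x Y =>
    rcases Fin.eq_zero_or_eq_succ i with rfl | ⟨i, rfl⟩
    · rcases Fin.eq_zero_or_eq_succ j with rfl | ⟨j, rfl⟩
      · exact absurd rfl hij
      · simp only [Fin.cons_zero, Fin.cons_succ] at hX
        subst hX
        exact key Y j
    · rcases Fin.eq_zero_or_eq_succ j with rfl | ⟨j, rfl⟩
      · simp only [Fin.cons_zero, Fin.cons_succ] at hX
        subst hX
        exact key Y i
      · rw [extDerivFun_cons, lieFun_eq_zero x η Y i j (by simpa using hX) (by simpa using hij),
          ih _ Y i j (by simpa using hX) (by simpa using hij), sub_zero]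


/-- The Lie algebroid differential `d_μ` on forms. -/
def extDeriv {k : ℕ} (η : Form R L k) : Form R L (k + 1) where
  toFun := extDerivFun η
  map_update_add' := by
    intro _ X i y z
    convert (extDerivFun_multilinear η).1 X i y z
  map_update_smul' := by
    intro _ X i c y
    rw [smul_eq_mul]
    convert (extDerivFun_multilinear η).2 X i c y
  map_eq_zero_of_eq' := fun X i j hX hij => extDerivFun_eq_zero η X i j hX hij

end differential

/-- The exterior product of forms (sum over shuffles). -/
def wedge {p q n : ℕ} (h : p + q = n) (α : Form R L p) (β : Form R L q) : Form R L n :=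
  ((LinearMap.mul' R R).compAlternatingMap (α.domCoprod β)).domDomCongr
    (finSumFinEquiv.trans (finCongr h))

/-- `Ω^♭ X = -i_X Ω`, that is, `(Ω^♭ X)(Y) = Ω(Y, X)`. -/
def flat (Ω : Form R L 2) : L →ₗ[R] Module.Dual R L :=
  LinearMap.mk₂ R (fun X Y => -Ω ![X, Y])
    (fun X X' Y => by
      have h := Ω.map_vecCons_add ![Y] X X'
      rw [h, neg_add])
    (fun c X Y => by
      have h := Ω.map_vecCons_smul ![Y] c X
      rw [h, smul_neg])
    (fun X Y Y' => by
      have h := (Ω.curryLeft X).map_vecCons_add ![] Y Y'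
      simp only [AlternatingMap.curryLeft_apply_apply] at h
      rw [h, neg_add])
    (fun c X Y => by
      have h := (Ω.curryLeft X).map_vecCons_smul ![] c Y
      simp only [AlternatingMap.curryLeft_apply_apply] at h
      rw [h, smul_neg])

theorem flat_skew (Ω : Form R L 2) (X Y : L) : Ω.flat X Y = -Ω.flat Y X := by
  have h := Ω.map_swap ![Y, X] (i := 0) (j := 1) (by decide)
  have h2 : (![Y, X] : Fin 2 → L) ∘ Equiv.swap 0 1 = ![X, Y] := by
    funext i; fin_cases i <;> rfl
  rw [h2] at h
  simp [flat, h]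

end Form

section bilin
variable {N : Type*} [AddCommGroup N] [Module R N]

/-- An alternating bilinear map, as an alternating map in two variables. -/
def alternatingOfBilin (B : L →ₗ[R] L →ₗ[R] N) (hB : ∀ x, B x x = 0) : L [⋀^Fin 2]→ₗ[R] N where
  toFun v := B (v 0) (v 1)
  map_update_add' := by
    intro _ v i x y
    fin_cases i
    · simp [Function.update_of_ne]
    · simp [Function.update_of_ne]
  map_update_smul' := by
    intro _ v i c x
    fin_cases i
    · simp [Function.update_of_ne]
    · simp [Function.update_of_ne]
  map_eq_zero_of_eq' := by
    intro v i j hv hij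
    fin_cases i <;> fin_cases j
    · exact absurd rfl hij
    · have h : v 0 = v 1 := hv
      rw [h, hB]
    · have h : v 1 = v 0 := hv
      rw [h, hB]
    · exact absurd rfl hij
end bilin

namespace Bivector

/-- The bilinear map sending `(X, Y)` to `α ↦ α(X) Y - α(Y) X`. -/
def sharpBilin : L →ₗ[R] L →ₗ[R] Module.Dual R L →ₗ[R] L :=
  LinearMap.mk₂ R
    (fun X Y : L => (Module.Dual.eval R L X).smulRight Y - (Module.Dual.eval R L Y).smulRight X)
    (fun X X' Y => by ext α; simp [add_smul]; abel)
    (fun c X Y => by ext α; simp [mul_smul, smul_sub, smul_comm c])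
    (fun X Y Y' => by ext α; simp [add_smul]; abel)
    (fun c X Y => by ext α; simp [mul_smul, smul_sub, smul_comm c])

theorem sharpBilin_self (X : L) : (sharpBilin X X : Module.Dual R L →ₗ[R] L) = 0 := by
  simp [sharpBilin]

/-- `π^♯ α = i_α π`; thus `(X ∧ Y)^♯ α = α(X) Y - α(Y) X`. -/
def sharp (π : Bivector R L) : Module.Dual R L →ₗ[R] L :=
  exteriorPower.alternatingMapLinearEquiv (alternatingOfBilin sharpBilin sharpBilin_self) π

/-- The interior product `i_π` of a form by a bivector, with `i_{X ∧ Y} = i_X ∘ i_Y`. -/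
def interior (π : Bivector R L) {k : ℕ} : Form R L (k + 2) →ₗ[R] Form R L k :=
  exteriorPower.alternatingMapLinearEquiv (alternatingOfBilin
    (LinearMap.mk₂ R
      (fun X Y : L =>
        { toFun := fun η : Form R L (k + 2) => (η.curryLeft Y).curryLeft X
          map_add' := fun _ _ => rfl
          map_smul' := fun _ _ => rfl } : L → L → (Form R L (k + 2) →ₗ[R] Form R L k))
      (fun X X' Y => by ext η v; exact (η.curryLeft Y).map_vecCons_add v X X')
      (fun c X Y => by ext η v; exact (η.curryLeft Y).map_vecCons_smul v c X)
      (fun X Y Y' => by ext η v; exact η.map_vecCons_add _ Y Y')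
      (fun c X Y => by ext η v; exact η.map_vecCons_smul _ c Y))
    (fun X => by ext η v; exact η.map_eq_zero_of_eq _ (by simp) Fin.zero_ne_one)) π

section brackets

variable [LieRingModule L R] [LieRinehartRing R L]

/-- The graded commutator `∂_π = [i_π, d] = i_π ∘ d - d ∘ i_π`, an operator of degree `-1`
on forms (on `1`-forms `i_π` vanishes). -/
def koszulOp (π : Bivector R L) : {k : ℕ} → Form R L (k + 1) → Form R L k
  | 0, η => π.interior η.extDeriv
  | _ + 1, η => π.interior η.extDeriv - (π.interior η).extDeriv

/-- The Koszul bracket of forms of positive degree,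
`[α, β]_π = (-1)^{|α|-1} (∂_π(α ∧ β) - ∂_π α ∧ β - (-1)^{|α|} α ∧ ∂_π β)`, where `|α| = p + 1`
and `|β| = q + 1`. It is the Gerstenhaber bracket on forms that extends the bracket
`[α, β]_π = ℒ_{π^♯ α} β - ℒ_{π^♯ β} α - d(π(α, β))` of `1`-forms. -/
def koszulBracket (π : Bivector R L) {p q : ℕ} (α : Form R L (p + 1)) (β : Form R L (q + 1)) :
    Form R L (p + q + 1) :=
  (-1 : ℤ) ^ p •
    (π.koszulOp (Form.wedge (n := p + q + 1 + 1) (by omega) α β) -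
      Form.wedge (by omega) (π.koszulOp α) β -
      (-1 : ℤ) ^ (p + 1) • Form.wedge (by omega) α (π.koszulOp β))

/-- The interior product of a form by the Schouten bracket `[P, Q]` of two bivectors, as the
derived bracket: `i_{[P, Q]} = [[i_P, d], i_Q]` (graded commutators of operators on forms). -/
def schoutenInterior (P Q : Bivector R L) {k : ℕ} (η : Form R L (k + 3)) : Form R L k :=
  P.koszulOp (Q.interior η) - Q.interior (P.koszulOp η)

/-- `π` is a Poisson bivector: `[π, π] = 0`. A trivector vanishes if and only if its interior
product with every form does. -/
def IsPoisson (π : Bivector R L) : Prop :=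
  ∀ (k : ℕ) (η : Form R L (k + 3)), schoutenInterior π π η = 0

/-- `Ω` is a complementary `2`-form for `π`: `[Ω, Ω]_π = 0`. -/
def IsComplementary (π : Bivector R L) (Ω : Form R L 2) : Prop :=
  π.koszulBracket (p := 1) (q := 1) Ω Ω = 0

end brackets

/-- The `(1,1)`-tensor `N = π^♯ ∘ Ω^♭`. -/
def tensorN (π : Bivector R L) (Ω : Form R L 2) : L →ₗ[R] L :=
  π.sharp ∘ₗ Ω.flat

theorem apply_sharp_self (π : Bivector R L) (α : Module.Dual R L) : α (π.sharp α) = 0 := by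
  have h : (α ∘ₗ LinearMap.applyₗ α) ∘ₗ exteriorPower.alternatingMapLinearEquiv
      (alternatingOfBilin sharpBilin sharpBilin_self) = (0 : ⋀[R]^2 L →ₗ[R] R) := by
    apply exteriorPower.linearMap_ext
    ext v
    simp [alternatingOfBilin, sharpBilin, mul_comm]
  exact LinearMap.congr_fun h π

/-- The `2`-form `Ω_N(X, Y) = Ω(NX, Y)`, where `N = π^♯ ∘ Ω^♭`. -/
def formN (π : Bivector R L) (Ω : Form R L 2) : Form R L 2 :=
  alternatingOfBilin (-(Ω.flat ∘ₗ π.tensorN Ω)) (fun X => by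
    have h := π.apply_sharp_self (Ω.flat X)
    have hs : ∀ Y, Ω.flat Y X = -Ω.flat X Y := fun Y => Ω.flat_skew Y X
    rw [LinearMap.neg_apply, LinearMap.neg_apply, LinearMap.comp_apply, hs, neg_neg]
    exact h)

/-- `Ω_N` is the `2`-form determined by `Ω_N^♭ = Ω^♭ ∘ N`. -/
theorem flat_formN (π : Bivector R L) (Ω : Form R L 2) :
    (π.formN Ω).flat = Ω.flat ∘ₗ π.tensorN Ω := by
  ext X Y
  simp [formN, Form.flat, alternatingOfBilin]

/-- The bivector `π` and the `2`-form `Ω` define a `PΩ`-structure: `π` is Poisson, `Ω` is closed and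
`Ω_N` is closed, where `N = π^♯ ∘ Ω^♭` and `Ω_N^♭ = Ω^♭ ∘ N`. -/
structure IsPOmega [LieRingModule L R] [LieRinehartRing R L] (π : Bivector R L)
    (Ω : Form R L 2) : Prop where
  isPoisson : π.IsPoisson
  closed : Ω.extDeriv = 0
  closed_formN : (π.formN Ω).extDeriv = 0

end Bivector
end Calculus

end

/-! The theorem follows from one identity: if `dΩ = 0`, then `[Ω, Ω]_π = 2 dΩ_N`. The Poisson
condition is common to both sides, and 2 can be cancelled in `C^∞(M)`, so for closed `Ω` the
vanishing of `[Ω, Ω]_π` and of `dΩ_N` are the same condition.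

For the identity put `f = i_π Ω`. The Koszul bracket measures the failure of `∂_π = [i_π, d]` to be
a derivation: `[Ω, Ω]_π = -(∂_π(Ω ∧ Ω) - ∂_πΩ ∧ Ω - Ω ∧ ∂_πΩ)`. Since `Ω` is closed, so is `Ω ∧ Ω`
(`extDeriv_wedge_self_eq_zero`), and on both forms `∂_π` reduces to `-d i_π`. Thus `∂_πΩ = -df`,
while the contraction formula `i_π(Ω ∧ Ω) = 2 (f Ω + Ω_N)` (`interior_wedge_self`) gives `∂_π(Ω ∧ Ω)
= -2 df ∧ Ω - 2 dΩ_N`. The terms in `df ∧ Ω` cancel and `2 dΩ_N` remains (`koszulBracket_self`).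

The argument is algebraic and runs over any Lie–Rinehart algebra whose base ring has no 2-torsion.
Exterior products and differentials are evaluated on explicit tuples of arguments. -/

section PoissonOmega

variable {R L : Type*} [CommRing R] [LieRing L] [Module R L]

/-! ### Exterior products in low degree -/

namespace Form

open scoped Nat in
/-- The exterior product as a sum over all permutations. -/
theorem factorial_mul_wedge_apply {p q n : ℕ} (h : p + q = n) (α : Form R L p) (β : Form R L q)
    (v : Fin n → L) :
    ((p ! * q ! : ℕ) : R) * wedge h α β v =
      ∑ σ : Equiv.Perm (Fin n), ((Equiv.Perm.sign σ : ℤ) : R) *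
        (α (fun i => v (σ (Fin.cast h (Fin.castAdd q i)))) *
          β (fun i => v (σ (Fin.cast h (Fin.natAdd p i))))) := by
  subst h
  -- Alternating the tensor product of `α` and `β` over all permutations counts every shuffle `p!
  -- q!` times, once for each rearrangement inside the two blocks.
  have key := DFunLike.congr_fun (MultilinearMap.domCoprod_alternization_eq α β)
    (v ∘ finSumFinEquiv)
  rw [MultilinearMap.alternatization_apply] at key
  have key' := congrArg (LinearMap.mul' R R) key
  rw [map_sum, AlternatingMap.smul_apply, map_nsmul, nsmul_eq_mul] at key'
  simp only [Fintype.card_fin] at key'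
  refine Eq.trans (Eq.trans ?_ key'.symm) ?_
  · rfl
  · refine Fintype.sum_equiv (Equiv.permCongr finSumFinEquiv) _ _ fun σ => ?_
    rw [Equiv.Perm.sign_permCongr, Units.smul_def, map_zsmul, zsmul_eq_mul]
    congr 1
    simp [MultilinearMap.domCoprod_apply, comp_def]

/-- A permutation is determined by the image `i` of 0 and a permutation of the remaining indices,
followed by `swap 0 i`. This makes signed sums expand recursively, like a determinant along a row.
-/
theorem sum_perm_fin_succ {n : ℕ} (f : Equiv.Perm (Fin (n + 1)) → R) :
    ∑ σ, f σ = ∑ i, ∑ σ, f (Equiv.Perm.decomposeFin.symm (i, σ)) := by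
  rw [Finset.univ_perm_fin_succ, ← Finset.univ_product_univ, Finset.sum_map, Finset.sum_product]
  rfl

theorem sum_sign_mul_fin_two (g : Fin 2 → Fin 2 → R) :
    ∑ σ : Equiv.Perm (Fin 2), ((Equiv.Perm.sign σ : ℤ) : R) * g (σ 0) (σ 1) =
      g 0 1 - g 1 0 := by
  rw [sum_perm_fin_succ, Fin.sum_univ_two]
  simp [sub_eq_add_neg]

theorem sum_sign_mul_fin_three (g : Fin 3 → Fin 3 → Fin 3 → R) :
    ∑ σ : Equiv.Perm (Fin 3), ((Equiv.Perm.sign σ : ℤ) : R) * g (σ 0) (σ 1) (σ 2) =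
      g 0 1 2 - g 0 2 1 - g 1 0 2 + g 1 2 0 + g 2 0 1 - g 2 1 0 := by
  rw [sum_perm_fin_succ]
  have h : ∀ (i : Fin 3) (σ : Equiv.Perm (Fin 2)),
      Equiv.Perm.decomposeFin.symm (i, σ) 2 = Equiv.swap 0 i (σ 1).succ :=
    fun i σ => Equiv.Perm.decomposeFin_symm_apply_succ σ i 1
  have key : ∀ i : Fin 3, _ := fun i =>
    sum_sign_mul_fin_two fun a b => g i (Equiv.swap 0 i a.succ) (Equiv.swap 0 i b.succ)
  simp only [Equiv.Perm.decomposeFin.symm_sign, Equiv.Perm.decomposeFin_symm_apply_zero,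
    Equiv.Perm.decomposeFin_symm_apply_one, h, Units.val_mul, Int.cast_mul, mul_assoc,
    ← Finset.mul_sum, key, Fin.sum_univ_three]
  have e1 : Equiv.swap (0 : Fin 3) 1 2 = 2 := by decide
  have e2 : Equiv.swap (0 : Fin 3) 2 1 = 1 := by decide
  simp [e1, e2]
  ring

theorem sum_sign_mul_fin_four (g : Fin 4 → Fin 4 → Fin 4 → Fin 4 → R) :
    ∑ σ : Equiv.Perm (Fin 4), ((Equiv.Perm.sign σ : ℤ) : R) * g (σ 0) (σ 1) (σ 2) (σ 3) =
      (g 0 1 2 3 - g 0 1 3 2 - g 0 2 1 3 + g 0 2 3 1 + g 0 3 1 2 - g 0 3 2 1) -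
      (g 1 0 2 3 - g 1 0 3 2 - g 1 2 0 3 + g 1 2 3 0 + g 1 3 0 2 - g 1 3 2 0) +
      (g 2 0 1 3 - g 2 0 3 1 - g 2 1 0 3 + g 2 1 3 0 + g 2 3 0 1 - g 2 3 1 0) -
      (g 3 0 1 2 - g 3 0 2 1 - g 3 1 0 2 + g 3 1 2 0 + g 3 2 0 1 - g 3 2 1 0) := by
  rw [sum_perm_fin_succ]
  have h2 : ∀ (i : Fin 4) (σ : Equiv.Perm (Fin 3)),
      Equiv.Perm.decomposeFin.symm (i, σ) 2 = Equiv.swap 0 i (σ 1).succ :=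
    fun i σ => Equiv.Perm.decomposeFin_symm_apply_succ σ i 1
  have h3 : ∀ (i : Fin 4) (σ : Equiv.Perm (Fin 3)),
      Equiv.Perm.decomposeFin.symm (i, σ) 3 = Equiv.swap 0 i (σ 2).succ :=
    fun i σ => Equiv.Perm.decomposeFin_symm_apply_succ σ i 2
  have key : ∀ i : Fin 4, _ := fun i => sum_sign_mul_fin_three fun a b c =>
    g i (Equiv.swap 0 i a.succ) (Equiv.swap 0 i b.succ) (Equiv.swap 0 i c.succ)
  simp only [Equiv.Perm.decomposeFin.symm_sign, Equiv.Perm.decomposeFin_symm_apply_zero,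
    Equiv.Perm.decomposeFin_symm_apply_one, h2, h3, Units.val_mul, Int.cast_mul, mul_assoc,
    ← Finset.mul_sum, key, Fin.sum_univ_four]
  have e1 : Equiv.swap (0 : Fin 4) 1 2 = 2 := by decide
  have e2 : Equiv.swap (0 : Fin 4) 2 1 = 1 := by decide
  have e3 : Equiv.swap (0 : Fin 4) 1 3 = 3 := by decide
  have e4 : Equiv.swap (0 : Fin 4) 2 3 = 3 := by decide
  have e5 : Equiv.swap (0 : Fin 4) 3 1 = 1 := by decide
  have e6 : Equiv.swap (0 : Fin 4) 3 2 = 2 := by decide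
  have s2 : (2 : Fin 3).succ = 3 := rfl
  simp [e1, e2, e3, e4, e5, e6, s2]
  ring

theorem vec_one (v : Fin 1 → L) : v = ![v 0] := by
  funext i; fin_cases i; rfl

theorem vec_two (v : Fin 2 → L) : v = ![v 0, v 1] := by
  funext i; fin_cases i <;> rfl

theorem apply_swap (Ω : Form R L 2) (x y : L) : Ω ![y, x] = -Ω ![x, y] := by
  have h := Ω.map_swap ![x, y] (i := 0) (j := 1) (by decide)
  have h2 : (![x, y] : Fin 2 → L) ∘ Equiv.swap 0 1 = ![y, x] := by
    funext i; fin_cases i <;> rfl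
  rwa [h2] at h

/-- The factor 2 is `1! 2!`. It stays on both sides because division by 2 is not available in a
general `R`. -/
theorem two_mul_wedge_one_two (α : Form R L 1) (Ω : Form R L 2) (x y z : L) :
    2 * wedge (n := 3) rfl α Ω ![x, y, z] =
      2 * (α ![x] * Ω ![y, z] - α ![y] * Ω ![x, z] + α ![z] * Ω ![x, y]) := by
  have h := factorial_mul_wedge_apply (n := 3) rfl α Ω ![x, y, z]
  have g := sum_sign_mul_fin_three fun a b c =>
    α ![![x, y, z] a] * Ω ![![x, y, z] b, ![x, y, z] c]
  simp only [vec_one (fun i : Fin 1 => ![x, y, z] _), vec_two (fun i : Fin 2 => ![x, y, z] _)] at h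
  have e := h.trans g
  simp [apply_swap Ω x y, apply_swap Ω x z, apply_swap Ω y z] at e
  linear_combination e

theorem two_mul_wedge_two_one (α : Form R L 1) (Ω : Form R L 2) (x y z : L) :
    2 * wedge (n := 3) rfl Ω α ![x, y, z] =
      2 * (α ![x] * Ω ![y, z] - α ![y] * Ω ![x, z] + α ![z] * Ω ![x, y]) := by
  have h := factorial_mul_wedge_apply (n := 3) rfl Ω α ![x, y, z]
  have g := sum_sign_mul_fin_three fun a b c =>
    Ω ![![x, y, z] a, ![x, y, z] b] * α ![![x, y, z] c]
  simp only [vec_one (fun i : Fin 1 => ![x, y, z] _), vec_two (fun i : Fin 2 => ![x, y, z] _)] at h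
  have e := h.trans g
  simp [apply_swap Ω x y, apply_swap Ω x z, apply_swap Ω y z] at e
  linear_combination e

/-- The outer 4 is `2! 2!`. The inner 2 arises because the six shuffles pair off: exchanging the two
equal factors leaves a term unchanged. -/
theorem four_mul_wedge_self (Ω : Form R L 2) (x y z w : L) :
    4 * wedge (n := 4) rfl Ω Ω ![x, y, z, w] =
      4 * (2 * (Ω ![x, y] * Ω ![z, w] - Ω ![x, z] * Ω ![y, w] + Ω ![x, w] * Ω ![y, z])) := by
  have h := factorial_mul_wedge_apply (n := 4) rfl Ω Ω ![x, y, z, w]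
  have g := sum_sign_mul_fin_four fun a b c d =>
    Ω ![![x, y, z, w] a, ![x, y, z, w] b] * Ω ![![x, y, z, w] c, ![x, y, z, w] d]
  simp only [vec_two (fun i : Fin 2 => ![x, y, z, w] _)] at h
  have e := h.trans g
  simp [apply_swap Ω x y, apply_swap Ω x z, apply_swap Ω y z, apply_swap Ω x w,
    apply_swap Ω y w, apply_swap Ω z w, Nat.factorial] at e
  linear_combination e

/-! ### The differential in low degree, and closedness of the square -/

variable [LieRingModule L R] [LieRinehartRing R L]

/-- Cartan's formula `i_x d = ℒ_x - d i_x`, which unfolds `d` one argument at a time. -/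
theorem extDeriv_vecCons {k : ℕ} (η : Form R L (k + 1)) (x : L) (Y : Fin (k + 1) → L) :
    η.extDeriv (Matrix.vecCons x Y) = lieFun x η Y - extDeriv (η.curryLeft x) Y :=
  extDerivFun_cons η x Y

/-- The commutation rule `i_y ℒ_x = ℒ_x i_y - i_{[x, y]}`, the companion of Cartan's formula in
these expansions. -/
theorem lieFun_vecCons {k : ℕ} (x : L) (η : Form R L (k + 1)) (y : L) (Y : Fin k → L) :
    lieFun x η (Matrix.vecCons y Y) =
      lieFun x (η.curryLeft y) Y - η (Matrix.vecCons ⁅x, y⁆ Y) := by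
  unfold lieFun
  rw [Fin.sum_univ_succ]
  simp only [Matrix.vecCons, Fin.update_cons_zero, ← Fin.cons_update, Fin.cons_zero, Fin.cons_succ,
    AlternatingMap.curryLeft_apply_apply]
  ring

theorem lieFun_vecEmpty (x : L) (η : Form R L 0) : lieFun x η ![] = ⁅x, η ![]⁆ := by
  simp [lieFun]

theorem extDeriv_add {k : ℕ} (η ζ : Form R L k) :
    extDeriv (η + ζ) = η.extDeriv + ζ.extDeriv := by
  ext v
  exact extDerivFun_add η ζ v

theorem extDeriv_two_smul {k : ℕ} (η : Form R L k) :
    extDeriv ((2 : R) • η) = (2 : R) • η.extDeriv := by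
  rw [two_smul, two_smul, extDeriv_add]

theorem extDeriv_apply_one (f : Form R L 0) (x : L) : f.extDeriv ![x] = ⁅x, f ![]⁆ := by
  have : (0 : Fin 1).removeNth ![x] = ![] := Subsingleton.elim _ _
  change extDerivFun f ![x] = _
  simp [extDerivFun, this]

theorem extDeriv_apply_three (Ω : Form R L 2) (x y z : L) :
    Ω.extDeriv ![x, y, z] = ⁅x, Ω ![y, z]⁆ - ⁅y, Ω ![x, z]⁆ + ⁅z, Ω ![x, y]⁆
      - Ω ![⁅x, y⁆, z] - Ω ![y, ⁅x, z⁆] + Ω ![x, ⁅y, z⁆] := by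
  rw [extDeriv_vecCons, extDeriv_vecCons, extDeriv_apply_one]
  simp only [lieFun_vecCons, lieFun_vecEmpty, AlternatingMap.curryLeft_apply_apply]
  ring

theorem extDeriv_apply_five (η : Form R L 4) (x₀ x₁ x₂ x₃ x₄ : L) :
    η.extDeriv ![x₀, x₁, x₂, x₃, x₄] =
      ⁅x₀, η ![x₁, x₂, x₃, x₄]⁆ - ⁅x₁, η ![x₀, x₂, x₃, x₄]⁆ + ⁅x₂, η ![x₀, x₁, x₃, x₄]⁆
      - ⁅x₃, η ![x₀, x₁, x₂, x₄]⁆ + ⁅x₄, η ![x₀, x₁, x₂, x₃]⁆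
      - η ![⁅x₀, x₁⁆, x₂, x₃, x₄] - η ![x₁, ⁅x₀, x₂⁆, x₃, x₄] - η ![x₁, x₂, ⁅x₀, x₃⁆, x₄]
      - η ![x₁, x₂, x₃, ⁅x₀, x₄⁆] + η ![x₀, ⁅x₁, x₂⁆, x₃, x₄] + η ![x₀, x₂, ⁅x₁, x₃⁆, x₄]
      + η ![x₀, x₂, x₃, ⁅x₁, x₄⁆] - η ![x₀, x₁, ⁅x₂, x₃⁆, x₄] - η ![x₀, x₁, x₃, ⁅x₂, x₄⁆]
      + η ![x₀, x₁, x₂, ⁅x₃, x₄⁆] := by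
  rw [extDeriv_vecCons, extDeriv_vecCons, extDeriv_vecCons, extDeriv_vecCons, extDeriv_apply_one]
  simp only [lieFun_vecCons, lieFun_vecEmpty, AlternatingMap.curryLeft_apply_apply]
  ring

/-- The reason is `d(Ω ∧ Ω) = 2 dΩ ∧ Ω`, verified on five arguments. -/
theorem extDeriv_wedge_self_eq_zero (h2 : ∀ r : R, 2 * r = 0 → r = 0) (Ω : Form R L 2)
    (hΩ : Ω.extDeriv = 0) : (wedge (n := 4) rfl Ω Ω).extDeriv = 0 := by
  -- The expression is written twice instead of with a factor 2, so that the Leibniz rule produces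
  -- no derivative of the constant 2.
  have hw : ∀ x y z w, wedge (n := 4) rfl Ω Ω ![x, y, z, w] =
      Ω ![x, y] * Ω ![z, w] - Ω ![x, z] * Ω ![y, w] + Ω ![x, w] * Ω ![y, z] +
      (Ω ![x, y] * Ω ![z, w] - Ω ![x, z] * Ω ![y, w] + Ω ![x, w] * Ω ![y, z]) := by
    intro x y z w
    refine sub_eq_zero.1 (h2 _ (h2 _ ?_))
    linear_combination four_mul_wedge_self Ω x y z w
  have hd : ∀ x y z, ⁅x, Ω ![y, z]⁆ - ⁅y, Ω ![x, z]⁆ + ⁅z, Ω ![x, y]⁆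
      + Ω ![z, ⁅x, y⁆] - Ω ![y, ⁅x, z⁆] + Ω ![x, ⁅y, z⁆] = 0 := by
    intro x y z
    rw [← sub_neg_eq_add _ (Ω ![z, ⁅x, y⁆]), ← apply_swap, ← extDeriv_apply_three, hΩ]; rfl
  have hs : ∀ x y z : L, Ω ![⁅x, y⁆, z] = -Ω ![z, ⁅x, y⁆] := fun x y z => apply_swap Ω _ _
  ext v
  have hv : v = ![v 0, v 1, v 2, v 3, v 4] := by funext i; fin_cases i <;> rfl
  rw [hv, extDeriv_apply_five]
  generalize v 0 = a, v 1 = b, v 2 = c, v 3 = d, v 4 = e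
  simp only [hw, lie_add, lie_sub, LieRinehartRing.leibniz_mul_right, smul_eq_mul,
    AlternatingMap.zero_apply, hs]
  -- These are the ten (3,2)-shuffles of `a, b, c, d, e` with their signs, that is, the expansion of
  -- `2 dΩ ∧ Ω`.
  linear_combination 2 * (hd a b c * Ω ![d, e] - hd a b d * Ω ![c, e] + hd a b e * Ω ![c, d]
    + hd a c d * Ω ![b, e] - hd a c e * Ω ![b, d] + hd a d e * Ω ![b, c]
    - hd b c d * Ω ![a, e] + hd b c e * Ω ![a, d] - hd b d e * Ω ![a, c] + hd c d e * Ω ![a, b])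

end Form

/-! ### Contraction of the square of a 2-form with a bivector -/

namespace Bivector

open Form

/-- A property of bivectors that is closed under linear combinations holds if it holds for
decomposable bivectors. -/
theorem induction_decomposable {P : Bivector R L → Prop} (hzero : P 0)
    (hadd : ∀ π π', P π → P π' → P (π + π')) (hsmul : ∀ (c : R) π, P π → P (c • π))
    (hmk : ∀ X Y : L, P (exteriorPower.ιMulti R 2 ![X, Y])) (π : Bivector R L) : P π := by
  have h : π ∈ Submodule.span R (Set.range (exteriorPower.ιMulti R 2 (M := L))) := by
    rw [exteriorPower.ιMulti_span]; trivial
  induction h using Submodule.span_induction with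
  | mem x hx =>
    obtain ⟨v, rfl⟩ := hx
    rw [vec_two v]
    exact hmk _ _
  | zero => exact hzero
  | add x y _ _ hx hy => exact hadd x y hx hy
  | smul c x _ hx => exact hsmul c x hx

theorem sharp_ιMulti (X Y : L) (α : Module.Dual R L) :
    sharp (exteriorPower.ιMulti R 2 ![X, Y]) α = α X • Y - α Y • X := by
  simp [sharp, alternatingOfBilin, sharpBilin]

theorem interior_ιMulti {k : ℕ} (X Y : L) (η : Form R L (k + 2)) :
    interior (exteriorPower.ιMulti R 2 ![X, Y]) η = (η.curryLeft Y).curryLeft X := by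
  simp [interior, alternatingOfBilin]

theorem formN_apply (π : Bivector R L) (Ω : Form R L 2) (x y : L) :
    π.formN Ω ![x, y] = Ω ![π.sharp (Ω.flat x), y] := by
  simp [formN, alternatingOfBilin, flat, tensorN]

/-- `i_π (Ω ∧ Ω) = 2 (i_π Ω) Ω + 2 Ω_N`. -/
theorem interior_wedge_self (h2 : ∀ r : R, 2 * r = 0 → r = 0) (π : Bivector R L)
    (Ω : Form R L 2) :
    π.interior (k := 2) (wedge (n := 4) rfl Ω Ω) =
      (2 : R) • (π.interior (k := 0) Ω ![] • Ω + π.formN Ω) := by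
  ext v
  rw [vec_two v]
  generalize v 0 = z, v 1 = w
  simp only [AlternatingMap.smul_apply, AlternatingMap.add_apply, formN_apply, smul_eq_mul]
  -- With `Ω`, `z`, `w` fixed, both sides are linear in `π`, so `π = X ∧ Y` suffices.
  induction π using induction_decomposable with
  | hzero =>
    have e : Ω ![0, w] = 0 := Ω.map_coord_zero 0 rfl
    simp [interior, sharp, e]
  | hadd π π' h h' =>
    have e : Ω ![(π + π').sharp (Ω.flat z), w] =
        Ω ![π.sharp (Ω.flat z), w] + Ω ![π'.sharp (Ω.flat z), w] := by
      simp only [sharp, map_add, LinearMap.add_apply]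
      exact Ω.map_vecCons_add _ _ _
    simp only [interior, map_add, LinearMap.add_apply, AlternatingMap.add_apply] at h h' ⊢
    rw [h, h', e]
    ring
  | hsmul c π h =>
    have e : Ω ![(c • π).sharp (Ω.flat z), w] = c * Ω ![π.sharp (Ω.flat z), w] := by
      simp only [sharp, map_smul, LinearMap.smul_apply]
      exact Ω.map_vecCons_smul _ _ _
    simp only [interior, map_smul, LinearMap.smul_apply, AlternatingMap.smul_apply,
      smul_eq_mul] at h ⊢
    rw [h, e]
    ring
  | hmk X Y =>
    have e : Ω ![Ω.flat z X • Y - Ω.flat z Y • X, w] =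
        Ω.flat z X * Ω ![Y, w] - Ω.flat z Y * Ω ![X, w] := by
      have h1 := Ω.map_vecCons_add ![w] (Ω.flat z X • Y) (-Ω.flat z Y • X)
      have h2 := Ω.map_vecCons_smul ![w] (Ω.flat z X) Y
      have h3 := Ω.map_vecCons_smul ![w] (-Ω.flat z Y) X
      rw [h2, h3, neg_smul, ← sub_eq_add_neg] at h1
      rw [h1]
      simp only [smul_eq_mul]
      ring
    rw [sharp_ιMulti, interior_ιMulti, interior_ιMulti, e]
    simp only [AlternatingMap.curryLeft_apply_apply, flat, LinearMap.mk₂_apply]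
    -- Here `i_X i_Y` inserts `Y` first, giving `(Ω ∧ Ω)(Y, X, z, w)`. The product `Ω(Y, X) Ω(z, w)`
    -- accounts for `(i_π Ω) Ω`, and the two mixed products account for `Ω_N`.
    have hw := four_mul_wedge_self Ω Y X z w
    refine sub_eq_zero.1 (h2 _ (h2 _ ?_))
    rw [apply_swap Ω X z, apply_swap Ω Y z] at *
    linear_combination hw

/-! ### The Koszul square of a closed 2-form, and the equivalence -/

variable [LieRingModule L R] [LieRinehartRing R L]

/-- For a closed `2`-form `Ω`, `[Ω, Ω]_π = 2 dΩ_N`. -/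
theorem koszulBracket_self (h2 : ∀ r : R, 2 * r = 0 → r = 0) (π : Bivector R L)
    (Ω : Form R L 2) (hΩ : Ω.extDeriv = 0) :
    π.koszulBracket (p := 1) (q := 1) Ω Ω = (2 : R) • (π.formN Ω).extDeriv := by
  have hop : π.koszulOp (k := 1) Ω = -(π.interior (k := 0) Ω).extDeriv := by
    change π.interior (k := 1) Ω.extDeriv - _ = _
    rw [hΩ, map_zero, zero_sub]
  have hop2 : π.koszulOp (k := 3) (wedge (n := 4) rfl Ω Ω) =
      -((2 : R) • (Form.extDeriv (π.interior (k := 0) Ω ![] • Ω) + (π.formN Ω).extDeriv)) := by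
    change π.interior (k := 3) (wedge (n := 4) rfl Ω Ω).extDeriv -
      (π.interior (k := 2) (wedge (n := 4) rfl Ω Ω)).extDeriv = _
    rw [extDeriv_wedge_self_eq_zero h2 Ω hΩ, map_zero, zero_sub, interior_wedge_self h2,
      extDeriv_two_smul, Form.extDeriv_add]
  -- Only the degrees are normalised: `p + q + 1` and its successor become the literals 3 and 4.
  have hb : π.koszulBracket (p := 1) (q := 1) Ω Ω =
      (-1 : ℤ) ^ 1 • (π.koszulOp (k := 3) (wedge (n := 4) rfl Ω Ω) -
        wedge (n := 3) rfl (π.koszulOp (k := 1) Ω) Ω -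
        (-1 : ℤ) ^ 2 • wedge (n := 3) rfl Ω (π.koszulOp (k := 1) Ω)) := rfl
  rw [hb, hop2, hop]
  ext v
  have hv : v = ![v 0, v 1, v 2] := by funext i; fin_cases i <;> rfl
  rw [hv]
  generalize v 0 = x, v 1 = y, v 2 = z
  -- This is `d(fΩ) = df ∧ Ω + f dΩ` with `f = i_π Ω`; the last term vanishes.
  have hsm : Form.extDeriv (π.interior (k := 0) Ω ![] • Ω) ![x, y, z] =
      ⁅x, π.interior (k := 0) Ω ![]⁆ * Ω ![y, z] - ⁅y, π.interior (k := 0) Ω ![]⁆ * Ω ![x, z] +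
        ⁅z, π.interior (k := 0) Ω ![]⁆ * Ω ![x, y] := by
    have hd := congrArg (fun η : Form R L 3 => η ![x, y, z]) hΩ
    simp only [extDeriv_apply_three, AlternatingMap.zero_apply] at hd
    rw [extDeriv_apply_three]
    simp only [AlternatingMap.smul_apply, smul_eq_mul, LieRinehartRing.leibniz_mul_right]
    linear_combination π.interior (k := 0) Ω ![] * hd
  -- A 1-form commutes with a 2-form, so both mixed terms of the bracket equal `-df ∧ Ω`; together
  -- they cancel the `df ∧ Ω` part of `∂_π(Ω ∧ Ω)`.
  have h12 := two_mul_wedge_one_two (-(π.interior (k := 0) Ω).extDeriv) Ω x y z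
  have h21 := two_mul_wedge_two_one (-(π.interior (k := 0) Ω).extDeriv) Ω x y z
  simp only [AlternatingMap.neg_apply, extDeriv_apply_one] at h12 h21
  -- The goal is doubled because `h12` and `h21` determine the exterior products only up to the
  -- factor 2.
  refine sub_eq_zero.1 (h2 _ ?_)
  simp only [pow_one, neg_smul, one_smul, even_two, Even.neg_pow, one_pow,
    AlternatingMap.neg_apply, AlternatingMap.sub_apply, AlternatingMap.smul_apply,
    AlternatingMap.add_apply, smul_eq_mul, hsm]
  linear_combination h12 + h21

theorem isPOmega_iff (h2 : ∀ r : R, 2 * r = 0 → r = 0) (π : Bivector R L) (Ω : Form R L 2)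
    (hπ : π.IsPoisson) : π.IsPOmega Ω ↔ Ω.extDeriv = 0 ∧ π.IsComplementary Ω := by
  constructor
  · intro h
    refine ⟨h.closed, ?_⟩
    rw [IsComplementary, koszulBracket_self h2 π Ω h.closed, h.closed_formN, smul_zero]
  · rintro ⟨hΩ, hc⟩
    refine ⟨hπ, hΩ, ?_⟩
    rw [IsComplementary, koszulBracket_self h2 π Ω hΩ] at hc
    ext v
    exact h2 _ (congrArg (fun η : Form R L 3 => η v) hc)

end Bivector
end PoissonOmega

/-! ### Lie algebroids over a manifold -/

theorem mainTheorem4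
    {E : Type*} [NormedAddCommGroup E] [NormedSpace ℝ E] [FiniteDimensional ℝ E]
    {M : Type*} [TopologicalSpace M] [T2Space M] [SigmaCompactSpace M]
    [ChartedSpace E M] [IsManifold 𝓘(ℝ, E) ∞ M]
    {F : Type*} [NormedAddCommGroup F] [NormedSpace ℝ F] [FiniteDimensional ℝ F]
    {A : M → Type*} [TopologicalSpace (Bundle.TotalSpace F A)]
    [∀ x, TopologicalSpace (A x)] [∀ x, AddCommGroup (A x)] [∀ x, Module ℝ (A x)]
    [FiberBundle F A] [VectorBundle ℝ F A] [ContMDiffVectorBundle ∞ F A 𝓘(ℝ, E)]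
    (𝓐 : LieAlgebroid E F A)
    (π : Bivector C^∞⟮𝓘(ℝ, E), M; ℝ⟯ 𝓐.Sec) (Ω : Form C^∞⟮𝓘(ℝ, E), M; ℝ⟯ 𝓐.Sec 2)
    (hπ : π.IsPoisson) :
    π.IsPOmega Ω ↔ Ω.extDeriv = 0 ∧ π.IsComplementary Ω := by
  -- The ring `C^∞(M)` has no 2-torsion, as evaluation at each point shows.
  refine Bivector.isPOmega_iff (fun r hr => ?_) π Ω hπ
  rw [two_mul] at hr
  ext x
  have h : r x + r x = 0 := congrArg (fun f : C^∞⟮𝓘(ℝ, E), M; ℝ⟯ => f x) hr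
  exact add_self_eq_zero.1 h
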